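/- Let $M=(E,\mathcal I)$ be a loopless matroid on a finite set $E$ with rank function $r$, and let $c=(c_1,\dots,c_m)$ be a sequence of integers with $m\ge 2$ and $0\le c_1<c_2<\dots<c_m\le r(E)$. For such a sequence (also of length one) let $P^{c}_{\mathcal I}(E)\subseteq\mathbb R^E$ be the convex hull of the incidence vectors $\chi^I$ of all $I\in\mathcal I$ with $|I|=c_q$ for some $q$; thus $P^{(k)}_{\mathcal I}(E)$ is the convex hull of the incidence vectors of the independent sets of cardinality $k$. For $x\in\mathbb R^E$ and $A\subseteq E$ put $x(A)=\sum_{e\in A}x_e$. A linear inequality that is valid for a polytope $P$ defines a facet of $P$ if the set of points of $P$ that satisfy it with equality is a nonempty face of dimension $\dim P-1$. A set $F\subseteq E$ is closed if $r(F)<r(F\cup\{e\})$ for all $e\in E\setminus F$. For $k\in\mathbb N$ and $A\subseteq E$ put $r^k(A)=k-r(E\setminus A)$; $A$ is $k$-separable if there is a partition $A=A_1\,\dot\cup\,A_2$ with $A_1\ne\emptyset\ne A_2$ and $r^k(A_1)+r^k(A_2)=r^k(A)$, and $k$-inseparable otherwise. Let $F\subseteq E$ with $c_p<r(F)<c_{p+1}$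 for some $p\in\{1,\dots,m-1\}$. Then the rank induced forbidden set inequality $$\mathrm{FS}_F(x):=(c_{p+1}-r(F))\,x(F)-(r(F)-c_p)\,x(E\setminus F)\ \le\ c_p\,(c_{p+1}-r(F))$$ defines a facet of $P^{c}_{\mathcal I}(E)$ if and only if one of the following conditions holds: (a) $c_p=c_1=0$ and the inequality $x(F)\le r(F)$ defines a facet of $P^{(c_{p+1})}_{\mathcal I}(E)$; (b) $c_p>0$, $F$ is closed, and (i) $E\setminus F$ is $c_{p+1}$-inseparable or (ii) $c_{p+1}<r(E)$. -/

import Mathlib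

namespace CardMatroid

variable {E : Type*} [Fintype E] [DecidableEq E]

/-- The rank `r(F)` of a set `F` in a matroid on a finite set, as a natural number. -/
noncomputable def rank (M : Matroid E) (F : Finset E) : ℕ :=
  (M.eRk (F : Set E)).toNat

/-- The incidence vector `χ^I ∈ ℝ^E`. -/
def incidence (I : Finset E) : E → ℝ :=
  fun e => if e ∈ I then 1 else 0

/-- The cardinality constrained matroid polytope `P^c(E)`: the convex hull of the incidence vectors
of the independent sets whose cardinality is a member of `c = (c_1, …, c_m)`. -/
def cardPolytope (M : Matroid E) {m : ℕ} (c : Fin m → ℕ) : Set (E → ℝ) :=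
  convexHull ℝ {x | ∃ I : Finset E, M.Indep (I : Set E) ∧ (∃ i, I.card = c i) ∧ x = incidence I}

/-- The linear form `x ↦ x(F) = ∑_{e ∈ F} x_e`. -/
def setSum (F : Finset E) : (E → ℝ) →ₗ[ℝ] ℝ :=
  ∑ e ∈ F, LinearMap.proj e

/-- The left-hand side
`FS_F(x) = (c_{p+1} - r(F)) x(F) - (r(F) - c_p) x(E ∖ F)` of the rank induced forbidden set
inequality, with `lo = c_p` and `hi = c_{p+1}`. -/
noncomputable def forbiddenSetForm (M : Matroid E) (lo hi : ℕ) (F : Finset E) :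
    (E → ℝ) →ₗ[ℝ] ℝ :=
  ((hi : ℝ) - (rank M F : ℝ)) • setSum F - ((rank M F : ℝ) - (lo : ℝ)) • setSum Fᶜ

/-- The dimension of (the affine hull of) a nonempty set. -/
noncomputable def affDim (S : Set (E → ℝ)) : ℕ :=
  Module.finrank ℝ (vectorSpan ℝ S)

/-- The linear inequality `a x ≤ b` defines a facet of `P`: it is valid for `P`, and the induced
face is nonempty and has dimension `dim P - 1`. -/
def DefinesFacet (P : Set (E → ℝ)) (a : (E → ℝ) →ₗ[ℝ] ℝ) (b : ℝ) : Prop :=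
  (∀ x ∈ P, a x ≤ b) ∧
    {x ∈ P | a x = b}.Nonempty ∧ affDim {x ∈ P | a x = b} + 1 = affDim P

/-- The `k`-rank `r^k(F) = k - r(E ∖ F)`. -/
noncomputable def kRank (M : Matroid E) (k : ℕ) (F : Finset E) : ℤ :=
  (k : ℤ) - (rank M Fᶜ : ℤ)

/-- `F` is `k`-separable if it has a partition into two nonempty sets on which the `k`-rank is
additive. -/
def KSeparable (M : Matroid E) (k : ℕ) (F : Finset E) : Prop :=
  ∃ F₁ F₂ : Finset E, F₁.Nonempty ∧ F₂.Nonempty ∧ Disjoint F₁ F₂ ∧ F₁ ∪ F₂ = F ∧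
    kRank M k F₁ + kRank M k F₂ = kRank M k F

/-- `F` is `k`-inseparable. -/
def KInseparable (M : Matroid E) (k : ℕ) (F : Finset E) : Prop :=
  ¬ KSeparable M k F

end CardMatroid

/-! The dimension of a hull of incidence vectors is `|E|` minus the dimension of the space of
weights that are constant on the underlying sets. The forbidden set inequality is tight on the
independent sets of size `c_p` inside `F` and on those of size `c_{p+1}` that meet `F` in a basis of
`F`. So for `c_p > 0` it defines a facet iff every weight constant on these sets is a multiple of
`FS_F`.

Since `c_p < r(F)`, the sets of the first kind force such a weight to be constant on `F`. Off `F`,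
the sets of the second kind run through the independent sets of size `d = c_{p+1} - r(F)` of the
contraction `M ／ F`. A weight constant on these must be constant on `E \ F` iff `M ／ F` is loopless
(that is, `F` is closed) and either `d` is less than the rank of `M ／ F` or `M ／ F` is connected;
for `c_{p+1} = r(E)` the separations of `M ／ F` are the `c_{p+1}`-separations of `E \ F`. Once the
weight takes one value on `F` and one off `F`, comparing the two kinds of sets fixes their ratio.

For `c_p = 0` the origin adds one dimension both to `P^{(c_{p+1})}` and to its face `x(F) = r(F)`.
-/

namespace CardMatroid

section AffineDimension

variable {K V : Type*} [Field K] [AddCommGroup V] [Module K V]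

theorem mem_dualAnnihilator_vectorSpan_iff {S : Set V} {φ : Module.Dual K V} :
    φ ∈ (vectorSpan K S).dualAnnihilator ↔ ∀ x ∈ S, ∀ y ∈ S, φ x = φ y := by
  rw [Submodule.mem_dualAnnihilator, vectorSpan_def]
  constructor
  · intro h x hx y hy
    have hxy := h _ (Submodule.subset_span (Set.vsub_mem_vsub hx hy))
    rwa [vsub_eq_sub, map_sub, sub_eq_zero] at hxy
  · intro h
    suffices Submodule.span K (S -ᵥ S) ≤ LinearMap.ker φ from fun w hw => this hw
    rw [Submodule.span_le]
    rintro _ ⟨x, hx, y, hy, rfl⟩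
    simp [h x hx y hy]

theorem finrank_vectorSpan_insert [Module.Finite K V] {S : Set V} (hS : S.Nonempty) {p : V}
    (hp : p ∉ affineSpan K S) :
    Module.finrank K (vectorSpan K (insert p S)) = Module.finrank K (vectorSpan K S) + 1 := by
  obtain ⟨s, hs⟩ := hS
  have hsS : s ∈ affineSpan K S := subset_affineSpan K S hs
  have hps : p - s ∉ vectorSpan K S := by
    rwa [← direction_affineSpan, ← vsub_eq_sub, AffineSubspace.vsub_right_mem_direction_iff_mem hsS]
  rw [← direction_affineSpan, ← affineSpan_insert_affineSpan,
    AffineSubspace.direction_affineSpan_insert hsS, direction_affineSpan, vsub_eq_sub, sup_comm,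
    Submodule.finrank_sup_span_singleton hps]

theorem notMem_affineSpan_of_forall_eq {S : Set V} {a : V →ₗ[K] K} {b : K}
    (ha : ∀ x ∈ S, a x = b) {p : V} (hp : a p ≠ b) : p ∉ affineSpan K S := by
  intro hpS
  have hS : (affineSpan K S).map a.toAffineMap ≤ affineSpan K {b} := by
    rw [AffineSubspace.map_span]
    exact affineSpan_mono K (Set.image_subset_iff.2 ha)
  exact hp ((AffineSubspace.mem_affineSpan_singleton K K).1 (hS ⟨p, hpS, rfl⟩))

end AffineDimension

section Faces

variable {𝕜 V : Type*} [Field 𝕜] [LinearOrder 𝕜] [IsStrictOrderedRing 𝕜] [AddCommGroup V]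
  [Module 𝕜 V]

theorem convex_setOf_le_and_imp_mem {C : Set V} (hC : Convex 𝕜 C) (a : V →ₗ[𝕜] 𝕜) (b : 𝕜) :
    Convex 𝕜 {x | a x ≤ b ∧ (a x = b → x ∈ C)} := by
  rw [convex_iff_forall_pos]
  rintro x ⟨hx, hxC⟩ y ⟨hy, hyC⟩ s t hs ht hst
  have hb : s * b + t * b = b := by rw [← add_mul, hst, one_mul]
  have hsx : s * a x ≤ s * b := mul_le_mul_of_nonneg_left hx hs.le
  have hty : t * a y ≤ t * b := mul_le_mul_of_nonneg_left hy ht.le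
  simp only [Set.mem_ofPred_eq, map_add, map_smul, smul_eq_mul]
  refine ⟨by linarith, fun h => hC (hxC ?_) (hyC ?_) hs.le ht.le hst⟩
  · exact mul_left_cancel₀ hs.ne' (by linarith)
  · exact mul_left_cancel₀ ht.ne' (by linarith)

theorem convexHull_inter_hyperplane {S : Set V} {a : V →ₗ[𝕜] 𝕜} {b : 𝕜} (hS : ∀ v ∈ S, a v ≤ b) :
    {x ∈ convexHull 𝕜 S | a x = b} = convexHull 𝕜 {v ∈ S | a v = b} := by
  apply Set.Subset.antisymm
  · rintro x ⟨hx, hxb⟩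
    have hsub : S ⊆ {x | a x ≤ b ∧ (a x = b → x ∈ convexHull 𝕜 {v ∈ S | a v = b})} :=
      fun v hv => ⟨hS v hv, fun h => subset_convexHull 𝕜 _ ⟨hv, h⟩⟩
    exact (convexHull_min hsub (convex_setOf_le_and_imp_mem (convex_convexHull 𝕜 _) a b) hx).2 hxb
  · exact convexHull_min (fun v hv => ⟨subset_convexHull 𝕜 _ hv.1, hv.2⟩)
      ((convex_convexHull 𝕜 S).inter (convex_hyperplane a.isLinear b))

end Faces

section Polytopes

variable {E : Type*}

theorem affDim_convexHull (S : Set (E → ℝ)) : affDim (convexHull ℝ S) = affDim S := by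
  rw [affDim, affDim, ← direction_affineSpan, affineSpan_convexHull, direction_affineSpan]

theorem definesFacet_convexHull_iff {S : Set (E → ℝ)} {a : (E → ℝ) →ₗ[ℝ] ℝ} {b : ℝ}
    (hS : ∀ v ∈ S, a v ≤ b) (hne : {v ∈ S | a v = b}.Nonempty) :
    DefinesFacet (convexHull ℝ S) a b ↔ affDim {v ∈ S | a v = b} + 1 = affDim S := by
  have hvalid : ∀ x ∈ convexHull ℝ S, a x ≤ b :=
    fun x hx => convexHull_min hS (convex_halfSpace_le a.isLinear b) hx
  rw [DefinesFacet, convexHull_inter_hyperplane hS, affDim_convexHull, affDim_convexHull]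
  exact ⟨fun h => h.2.2, fun h => ⟨hvalid, hne.convexHull, h⟩⟩

end Polytopes

section IncidenceVectors

variable {E : Type*}

theorem setSum_apply (F : Finset E) (x : E → ℝ) : setSum F x = ∑ e ∈ F, x e := by
  simp [setSum]

/-- The weights on the ground set under which all members of `𝓘` have the same total weight; these
are the linear forms that are constant on the incidence vectors of `𝓘`. -/
def constSumWeights (𝓘 : Set (Finset E)) : Submodule ℝ (E → ℝ) where
  carrier := {w | ∀ I ∈ 𝓘, ∀ J ∈ 𝓘, ∑ e ∈ I, w e = ∑ e ∈ J, w e}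
  add_mem' hv hw I hI J hJ := by
    simp only [Pi.add_apply, Finset.sum_add_distrib, hv I hI J hJ, hw I hI J hJ]
  zero_mem' I _ J _ := by simp
  smul_mem' t w hw I hI J hJ := by
    simp only [Pi.smul_apply, smul_eq_mul, ← Finset.mul_sum, hw I hI J hJ]

variable {𝓘 𝓙 : Set (Finset E)}

theorem mem_constSumWeights {w : E → ℝ} :
    w ∈ constSumWeights 𝓘 ↔ ∀ I ∈ 𝓘, ∀ J ∈ 𝓘, ∑ e ∈ I, w e = ∑ e ∈ J, w e :=
  Iff.rfl

theorem mem_constSumWeights_of_forall_eq {w : E → ℝ} {γ : ℝ} (h : ∀ I ∈ 𝓘, ∑ e ∈ I, w e = γ) :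
    w ∈ constSumWeights 𝓘 :=
  fun I hI J hJ => (h I hI).trans (h J hJ).symm

theorem exists_forall_sum_eq_of_mem_constSumWeights {w : E → ℝ} (hw : w ∈ constSumWeights 𝓘) :
    ∃ γ : ℝ, ∀ I ∈ 𝓘, ∑ e ∈ I, w e = γ := by
  rcases 𝓘.eq_empty_or_nonempty with rfl | ⟨J, hJ⟩
  · simp
  · exact ⟨_, fun I hI => hw I hI J hJ⟩

theorem constSumWeights_anti (h : 𝓘 ⊆ 𝓙) : constSumWeights 𝓙 ≤ constSumWeights 𝓘 :=
  fun _ hw I hI J hJ => hw I (h hI) J (h hJ)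

variable [DecidableEq E]

theorem setSum_incidence (F I : Finset E) : setSum F (incidence I) = ((I ∩ F).card : ℝ) := by
  simp [setSum_apply, incidence, Finset.inter_comm]

theorem setSum_single (F : Finset E) (e : E) :
    setSum F (Pi.single e 1) = if e ∈ F then 1 else 0 := by
  simp [setSum_apply, Pi.single_apply]

theorem affDim_incidence_insert_empty [Finite E] {k : ℕ} (hk : k ≠ 0) (hne : 𝓘.Nonempty)
    (h𝓘 : ∀ I ∈ 𝓘, I.card = k) :
    affDim (incidence '' insert ∅ 𝓘) = affDim (incidence '' 𝓘) + 1 := by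
  have := Fintype.ofFinite E
  rw [Set.image_insert_eq]
  refine finrank_vectorSpan_insert (hne.image _)
    (notMem_affineSpan_of_forall_eq (a := setSum Finset.univ) (b := k) ?_ ?_)
  · rintro _ ⟨I, hI, rfl⟩
    rw [setSum_incidence, Finset.inter_univ, h𝓘 I hI]
  · rw [setSum_incidence, Finset.inter_univ, Finset.card_empty]
    exact_mod_cast hk.symm

variable [Fintype E]

theorem dotProductEquiv_incidence (w : E → ℝ) (I : Finset E) :
    dotProductEquiv ℝ E w (incidence I) = ∑ e ∈ I, w e := by
  simp [dotProduct, incidence]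

theorem constSumWeights_eq_comap (𝓘 : Set (Finset E)) :
    constSumWeights 𝓘 = (vectorSpan ℝ (incidence '' 𝓘)).dualAnnihilator.comap
      (dotProductEquiv ℝ E).toLinearMap := by
  ext w
  simp only [mem_constSumWeights, Submodule.mem_comap, LinearEquiv.coe_coe,
    mem_dualAnnihilator_vectorSpan_iff, Set.forall_mem_image, dotProductEquiv_incidence]

theorem affDim_incidence_add_finrank_constSumWeights (𝓘 : Set (Finset E)) :
    affDim (incidence '' 𝓘) + Module.finrank ℝ (constSumWeights 𝓘) = Fintype.card E := by
  rw [constSumWeights_eq_comap,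
    ((dotProductEquiv ℝ E).ofSubmodule' _).finrank_eq, affDim,
    Subspace.finrank_add_finrank_dualAnnihilator_eq, Module.finrank_fintype_fun_eq_card]

theorem affDim_incidence_eq_card_of_constSumWeights_eq_bot (h : constSumWeights 𝓘 = ⊥) :
    affDim (incidence '' 𝓘) = Fintype.card E := by
  rw [← affDim_incidence_add_finrank_constSumWeights 𝓘, h, finrank_bot, add_zero]

theorem affDim_incidence_add_one_eq_card_iff {a : (E → ℝ) →ₗ[ℝ] ℝ} {b : ℝ} (ha : a ≠ 0)
    (hab : ∀ I ∈ 𝓘, a (incidence I) = b) :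
    affDim (incidence '' 𝓘) + 1 = Fintype.card E ↔
      ∀ w ∈ constSumWeights 𝓘, ∃ t : ℝ, ∀ e, w e = t * a (Pi.single e 1) := by
  set u : E → ℝ := (dotProductEquiv ℝ E).symm a with hu
  have hua : dotProductEquiv ℝ E u = a := (dotProductEquiv ℝ E).apply_symm_apply a
  have hu_mem : u ∈ constSumWeights 𝓘 := mem_constSumWeights_of_forall_eq (γ := b) fun I hI => by
    rw [← dotProductEquiv_incidence, hua, hab I hI]
  have hu_ne : (⟨u, hu_mem⟩ : constSumWeights 𝓘) ≠ 0 := by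
    simpa [Subtype.ext_iff, hu] using ha
  have hu_apply : ∀ e, u e = a (Pi.single e 1) := fun e => rfl
  rw [← affDim_incidence_add_finrank_constSumWeights 𝓘, add_right_inj, eq_comm,
    finrank_eq_one_iff_of_nonzero' _ hu_ne]
  simp only [Subtype.forall, Subtype.ext_iff, Submodule.coe_smul, funext_iff, Pi.smul_apply,
    smul_eq_mul, hu_apply, eq_comm]

end IncidenceVectors

open scoped Matroid

section Rank

variable {E : Type*} {M : Matroid E} {I F : Finset E}

theorem coe_rank (M : Matroid E) (F : Finset E) : (rank M F : ℕ∞) = M.eRk (F : Set E) := by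
  rw [rank, ENat.natCast_toNat]
  exact ((M.eRk_le_encard _).trans_lt F.finite_toSet.encard_lt_top).ne

theorem coe_rank_univ [Fintype E] (M : Matroid E) : (rank M Finset.univ : ℕ∞) = M.eRank := by
  rw [coe_rank, Finset.coe_univ, Matroid.eRk_univ_eq]

theorem card_le_rank (hI : M.Indep (I : Set E)) (hIF : I ⊆ F) : I.card ≤ rank M F := by
  have h := hI.encard_le_eRk_of_subset (Finset.coe_subset.2 hIF)
  rw [← coe_rank, Set.encard_coe_eq_coe_finsetCard] at h
  exact_mod_cast h

theorem rank_eq_card (hI : M.IsBasis' (I : Set E) (F : Set E)) : rank M F = I.card := by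
  rw [← Nat.cast_inj (R := ℕ∞), coe_rank, hI.eRk_eq_encard, Set.encard_coe_eq_coe_finsetCard]

theorem rank_le_card (M : Matroid E) (F : Finset E) : rank M F ≤ F.card := by
  rw [← Nat.cast_le (α := ℕ∞), coe_rank, ← Set.encard_coe_eq_coe_finsetCard]
  exact M.eRk_le_encard _

theorem exists_isBasis'_superset (hI : M.Indep (I : Set E)) (hIF : I ⊆ F) :
    ∃ B : Finset E, I ⊆ B ∧ M.IsBasis' (B : Set E) (F : Set E) := by
  obtain ⟨B, hB, hIB⟩ := hI.subset_isBasis'_of_subset (Finset.coe_subset.2 hIF)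
  lift B to Finset E using F.finite_toSet.subset hB.subset
  exact ⟨B, Finset.coe_subset.1 hIB, hB⟩

theorem exists_isBasis' (M : Matroid E) (F : Finset E) :
    ∃ B : Finset E, M.IsBasis' (B : Set E) (F : Set E) := by
  obtain ⟨B, -, hB⟩ := exists_isBasis'_superset (M := M) (I := ∅) (by simp) (Finset.empty_subset F)
  exact ⟨B, hB⟩

theorem isBasis'_of_rank_le_card (hI : M.Indep (I : Set E)) (hIF : I ⊆ F)
    (h : rank M F ≤ I.card) : M.IsBasis' (I : Set E) (F : Set E) := by
  obtain ⟨B, hIB, hB⟩ := exists_isBasis'_superset hI hIF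
  rwa [Finset.eq_of_subset_of_card_le hIB (by rwa [← rank_eq_card hB])]

theorem exists_indep_superset_card_eq {n : ℕ} (hI : M.Indep (I : Set E)) (hIn : I.card ≤ n)
    (hn : n ≤ M.eRank) : ∃ J : Finset E, I ⊆ J ∧ M.Indep (J : Set E) ∧ J.card = n := by
  obtain ⟨B, hB, hIB⟩ := hI.exists_isBase_superset
  obtain ⟨J, hIJ, hJB, hJ⟩ := Set.exists_superset_subset_encard_eq (k := n) hIB
    (by rw [Set.encard_coe_eq_coe_finsetCard]; exact_mod_cast hIn)
    (by rwa [hB.encard_eq_eRank])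
  lift J to Finset E using Set.finite_of_encard_eq_coe hJ
  rw [Set.encard_coe_eq_coe_finsetCard] at hJ
  exact ⟨J, Finset.coe_subset.1 hIJ, hB.indep.subset hJB, by exact_mod_cast hJ⟩

theorem eRk_contract_add_eRk (M : Matroid E) (A C : Set E) :
    (M ／ C).eRk A + M.eRk C = M.eRk (A ∪ C) := by
  obtain ⟨I, hI⟩ := M.exists_isBasis' C
  obtain ⟨B, hB, hIB⟩ := hI.indep.subset_isBasis'_of_subset
    (hI.subset.trans (Set.subset_union_right (s := A)))
  have hBC : B ∩ C = I :=
    (hI.eq_of_subset_indep (hB.indep.inter_right C) (Set.subset_inter hIB hI.subset)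
      Set.inter_subset_right).symm
  have hBI : B \ C ∪ I = B := by rw [← hBC, Set.sdiff_union_inter]
  have hBC' : (M ／ C).IsBasis' (B \ C) ((A ∪ C) \ C) :=
    hB.contract_isBasis' hI (hBI.symm ▸ hB.indep)
  have hA : (M ／ C).eRk ((A ∪ C) \ C) = (M ／ C).eRk A := by
    rw [← (M ／ C).eRk_inter_ground A, ← (M ／ C).eRk_inter_ground ((A ∪ C) \ C)]
    congr 1
    ext x
    simp only [Matroid.contract_ground, Set.mem_inter_iff, Set.mem_sdiff, Set.mem_union]
    tauto
  rw [← hA, hBC'.eRk_eq_encard, hI.eRk_eq_encard, hB.eRk_eq_encard, ← hBC,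
    Set.encard_sdiff_add_encard_inter]

theorem rank_contract_add_rank [DecidableEq E] (M : Matroid E) (A F : Finset E) :
    rank (M ／ (F : Set E)) A + rank M F = rank M (A ∪ F) := by
  rw [← Nat.cast_inj (R := ℕ∞), Nat.cast_add, coe_rank, coe_rank, coe_rank, Finset.coe_union,
    eRk_contract_add_eRk]

theorem rank_univ_contract_add_rank [Fintype E] (M : Matroid E) (F : Finset E) :
    rank (M ／ (F : Set E)) Finset.univ + rank M F = rank M Finset.univ := by
  classical
  rw [rank_contract_add_rank, Finset.union_eq_left.2 (Finset.subset_univ F)]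

theorem loopless_contract_iff_isFlat {F : Set E} (hF : F ⊆ M.E) :
    (M ／ F).Loopless ↔ M.IsFlat F := by
  rw [Matroid.loopless_iff, Matroid.contract_loops_eq, Set.sdiff_eq_empty,
    Matroid.isFlat_iff_closure_eq]
  exact ⟨fun h => h.antisymm (M.subset_closure F), fun h => h.le⟩

end Rank

section Rigidity

variable {E : Type*} {N : Matroid E} {k : ℕ} {w : E → ℝ} {e f : E}

/-- The independent sets of cardinality `k`. -/
def indepSetsOfCard (M : Matroid E) (k : ℕ) : Set (Finset E) :=
  {I | M.Indep (I : Set E) ∧ I.card = k}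

/-- `N` is `k`-rigid if every weight under which all independent sets of cardinality `k` have the
same total weight is constant on the ground set. -/
def CardRigid (N : Matroid E) (k : ℕ) : Prop :=
  ∀ w ∈ constSumWeights (indepSetsOfCard N k), ∀ e ∈ N.E, ∀ f ∈ N.E, w e = w f

/-- A matroid of finite rank is separable if its ground set has a partition into two nonempty sets
on which the rank is additive, that is, if the matroid is not connected. -/
def Separable (N : Matroid E) : Prop :=
  ∃ A₁ A₂ : Set E, A₁.Nonempty ∧ A₂.Nonempty ∧ Disjoint A₁ A₂ ∧ A₁ ∪ A₂ = N.E ∧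
    N.eRk A₁ + N.eRk A₂ = N.eRank

theorem indepSetsOfCard_zero (M : Matroid E) : indepSetsOfCard M 0 = {∅} := by
  ext I
  simp only [indepSetsOfCard, Set.mem_ofPred_eq, Finset.card_eq_zero, Set.mem_singleton_iff,
    and_iff_right_iff_imp]
  rintro rfl
  simp

theorem indepSetsOfCard_nonempty (hk : k ≤ N.eRank) : (indepSetsOfCard N k).Nonempty := by
  obtain ⟨J, -, hJ⟩ := exists_indep_superset_card_eq (M := N) (I := ∅) (by simp)
    (Nat.zero_le k) hk
  exact ⟨J, hJ⟩

theorem eq_of_indep_insert (hw : w ∈ constSumWeights (indepSetsOfCard N (k + 1))) {J : Finset E}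
    (hJ : J.card = k) (he : e ∉ J) (hf : f ∉ J) (heJ : N.Indep (insert e (J : Set E)))
    (hfJ : N.Indep (insert f (J : Set E))) : w e = w f := by
  classical
  have hsum := hw (insert e J) ⟨by simpa using heJ, by rw [Finset.card_insert_of_notMem he, hJ]⟩
    (insert f J) ⟨by simpa using hfJ, by rw [Finset.card_insert_of_notMem hf, hJ]⟩
  rw [Finset.sum_insert he, Finset.sum_insert hf] at hsum
  exact add_right_cancel hsum

theorem exists_indep_card_eq_notMem_closure (he : N.IsNonloop e) (hf : N.IsNonloop f)
    (hk : (k + 1 : ℕ) < N.eRank) :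
    ∃ J : Finset E, N.Indep (J : Set E) ∧ J.card = k ∧
      e ∉ N.closure (J : Set E) ∧ f ∉ N.closure (J : Set E) := by
  classical
  by_cases hcl : N.closure {e} = N.closure {f}
  · obtain ⟨J, heJ, hJ, hJk⟩ := exists_indep_superset_card_eq (I := {e}) (n := k + 1)
      (by simpa using he) (by simp) hk.le
    have heJ : e ∈ J := heJ (Finset.mem_singleton_self e)
    have he_cl : e ∉ N.closure ((J.erase e : Finset E) : Set E) := by
      rw [Finset.coe_erase]
      exact hJ.notMem_closure_sdiff_of_mem heJ
    refine ⟨J.erase e, hJ.subset (by simp), by simp [heJ, hJk], he_cl, fun hf_cl => he_cl ?_⟩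
    have hsub := N.closure_subset_closure_of_subset_closure (Set.singleton_subset_iff.2 hf_cl)
    exact hsub (hcl ▸ N.mem_closure_self e he.mem_ground)
  · rw [he.closure_eq_closure_iff_eq_or_dep hf, not_or, not_not] at hcl
    obtain ⟨hef, hind⟩ := hcl
    obtain ⟨J, hefJ, hJ, hJk⟩ := exists_indep_superset_card_eq (I := {e, f}) (n := k + 2)
      (by simpa using hind) (by simp [Finset.card_pair hef]) (Order.add_one_le_of_lt hk)
    have heJ : e ∈ J := hefJ (by simp)
    have hfJ : f ∈ J := hefJ (by simp)
    have hcl : ∀ x ∈ J, ∀ I ⊆ J.erase x, x ∉ N.closure (I : Set E) := fun x hx I hI hmem =>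
      hJ.notMem_closure_sdiff_of_mem hx (N.closure_subset_closure (by exact_mod_cast hI) hmem)
    refine ⟨(J.erase e).erase f, hJ.subset ?_, by simp [heJ, hfJ, Ne.symm hef, hJk],
      hcl e heJ _ (Finset.erase_subset _ _), hcl f hfJ _ ?_⟩
    · exact_mod_cast (Finset.erase_subset _ _).trans (Finset.erase_subset _ _)
    · exact Finset.erase_subset_erase f (Finset.erase_subset e J)

theorem cardRigid_of_lt_eRank [N.Loopless] (hk : 0 < k) (hkr : k < N.eRank) : CardRigid N k := by
  obtain ⟨k, rfl⟩ := Nat.exists_eq_succ_of_ne_zero hk.ne'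
  intro w hw e he f hf
  obtain ⟨J, hJ, hJk, heJ, hfJ⟩ := exists_indep_card_eq_notMem_closure
    (N.isNonloop_of_loopless he) (N.isNonloop_of_loopless hf) hkr
  rw [hJ.notMem_closure_iff] at heJ hfJ
  exact eq_of_indep_insert hw hJk heJ.2 hfJ.2 heJ.1 hfJ.1

theorem isBasis_inter_of_forall_not_indep_exchange {B X : Set E} (hB : N.IsBase B) (hX : X ⊆ N.E)
    (h : ∀ f ∈ X \ B, ∀ e ∈ B \ X, ¬ N.Indep (insert f (B \ {e}))) : N.IsBasis (B ∩ X) X := by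
  refine (hB.indep.inter_right X).isBasis_of_subset_of_subset_closure Set.inter_subset_right ?_
  intro f hfX
  by_cases hfB : f ∈ B
  · exact N.mem_closure_of_mem' ⟨hfB, hfX⟩ (hX hfX)
  -- An element of the fundamental circuit of `f` outside `X` could be exchanged for `f`.
  have hC := hB.fundCircuit_isCircuit (hX hfX) hfB
  refine N.closure_subset_closure ?_
    (hC.mem_closure_sdiff_singleton_of_mem (N.mem_fundCircuit f B))
  rintro x ⟨hxC, hxf⟩
  have hxB : x ∈ B := (N.fundCircuit_subset_insert f B hxC).resolve_left hxf
  rw [hB.indep.mem_fundCircuit_iff (hB.closure_eq ▸ hX hfX) hfB] at hxC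
  by_contra hxX
  refine h f ⟨hfX, hfB⟩ x ⟨hxB, fun hx => hxX ⟨hxB, hx⟩⟩ ?_
  rwa [Set.insert_sdiff_singleton_comm (Ne.symm hxf)]

theorem eRk_eq_encard_inter_of_forall_ne {B : Finset E} (hB : N.IsBase (B : Set E))
    (hw : w ∈ constSumWeights (indepSetsOfCard N B.card)) {X : Set E} (hX : X ⊆ N.E)
    (hwX : ∀ x ∈ X, ∀ y ∈ N.E \ X, w x ≠ w y) : N.eRk X = ((B : Set E) ∩ X).encard := by
  classical
  refine (isBasis_inter_of_forall_not_indep_exchange hB hX ?_).eRk_eq_encard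
  rintro f ⟨hfX, hfB⟩ e ⟨heB, heX⟩ hind
  have hfB : f ∉ B := hfB
  have heB : e ∈ B := heB
  refine hwX f hfX e ⟨hB.subset_ground heB, heX⟩
    (eq_of_indep_insert (N := N) (J := B.erase e) (k := B.card - 1) ?_ ?_ ?_ ?_ ?_ ?_)
  · rwa [Nat.sub_add_cancel (Finset.card_pos.2 ⟨e, heB⟩)]
  · exact Finset.card_erase_of_mem heB
  · simp [hfB]
  · simp
  · rwa [Finset.coe_erase]
  · rw [← Finset.coe_insert, Finset.insert_erase heB]
    exact hB.indep

theorem separable_of_mem_constSumWeights [N.RankFinite] (hk : k = N.eRank)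
    (hw : w ∈ constSumWeights (indepSetsOfCard N k)) (he : e ∈ N.E) (hf : f ∈ N.E)
    (hef : w e ≠ w f) : Separable N := by
  obtain ⟨B, hB⟩ := N.exists_isBase
  lift B to Finset E using hB.finite
  have hBk : k = B.card := by
    rw [← hB.encard_eq_eRank, Set.encard_coe_eq_coe_finsetCard] at hk
    exact_mod_cast hk
  rw [hBk] at hw
  have hsub : {x ∈ N.E | w x = w e} ⊆ N.E := Set.sep_subset _ _
  refine ⟨{x ∈ N.E | w x = w e}, N.E \ {x ∈ N.E | w x = w e}, ⟨e, he, rfl⟩,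
    ⟨f, hf, fun h => hef h.2.symm⟩, Set.disjoint_sdiff_right, Set.union_sdiff_cancel hsub, ?_⟩
  rw [eRk_eq_encard_inter_of_forall_ne hB hw hsub, eRk_eq_encard_inter_of_forall_ne hB hw
    Set.sdiff_subset, ← hB.encard_eq_eRank, ← Set.inter_sdiff_assoc,
    Set.inter_eq_self_of_subset_left hB.subset_ground]
  · rw [add_comm, Set.encard_sdiff_add_encard_inter]
  · rintro x ⟨hx, hxe⟩ y ⟨hy, hye⟩ hxy
    exact hxe ⟨hx, hxy.trans (by simpa [hy] using hye)⟩
  · rintro x ⟨-, hxe⟩ y ⟨hy, hye⟩ hxy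
    exact hye ⟨hy, hxy.symm.trans hxe⟩

theorem loopless_of_cardRigid (hk : 0 < k) (hkr : k ≤ N.eRank) (h : CardRigid N k) :
    N.Loopless := by
  classical
  rw [Matroid.loopless_iff_forall_not_isLoop]
  intro e he hloop
  have hw : Pi.single e 1 ∈ constSumWeights (indepSetsOfCard N k) :=
    mem_constSumWeights_of_forall_eq (γ := 0) fun I hI => by
      simpa [Finset.sum_pi_single] using fun heI => (hI.1.isNonloop_of_mem heI).not_isLoop hloop
  obtain ⟨J, hJ, hJk⟩ := indepSetsOfCard_nonempty hkr
  obtain ⟨f, hf⟩ := Finset.card_pos.1 (hk.trans_eq hJk.symm)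
  have hfe : f ≠ e := fun hfe => (hJ.isNonloop_of_mem (hfe ▸ hf)).not_isLoop hloop
  simpa [hfe] using h _ hw e he f (hJ.subset_ground hf)

theorem card_inter_eq_rank_of_separation [DecidableEq E] {A₁ A₂ I : Finset E}
    (hdisj : Disjoint A₁ A₂) (hunion : (A₁ : Set E) ∪ A₂ = N.E)
    (hrank : rank N A₁ + rank N A₂ = k) (hI : I ∈ indepSetsOfCard N k) :
    (I ∩ A₁).card = rank N A₁ ∧ (I ∩ A₂).card = rank N A₂ := by
  have hle : ∀ A : Finset E, (I ∩ A).card ≤ rank N A := fun A =>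
    card_le_rank (hI.1.subset (by simp)) Finset.inter_subset_right
  have hI_sub : I ⊆ A₁ ∪ A₂ := by
    rw [← Finset.coe_subset, Finset.coe_union, hunion]
    exact hI.1.subset_ground
  have hsum : (I ∩ A₁).card + (I ∩ A₂).card = k := by
    rw [← Finset.card_union_of_disjoint (hdisj.mono Finset.inter_subset_right
      Finset.inter_subset_right), ← Finset.inter_union_distrib_left,
      Finset.inter_eq_left.2 hI_sub, hI.2]
  have h₁ := hle A₁
  have h₂ := hle A₂
  omega

theorem not_cardRigid_of_separable [Finite E] (hk : 0 < k) (hkr : k = N.eRank)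
    (h : Separable N) : ¬ CardRigid N k := by
  classical
  obtain ⟨A₁, A₂, ⟨e₁, he₁⟩, ⟨e₂, he₂⟩, hdisj, hunion, hrank⟩ := h
  lift A₁ to Finset E using A₁.toFinite
  lift A₂ to Finset E using A₂.toFinite
  rw [Finset.disjoint_coe] at hdisj
  replace hrank : rank N A₁ + rank N A₂ = k := by
    rw [← hkr, ← coe_rank, ← coe_rank] at hrank
    exact_mod_cast hrank
  intro hrigid
  set w : E → ℝ := fun e =>
    rank N A₂ * (if e ∈ A₁ then 1 else 0) - rank N A₁ * (if e ∈ A₂ then 1 else 0) with hw_def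
  have hw : w ∈ constSumWeights (indepSetsOfCard N k) :=
    mem_constSumWeights_of_forall_eq (γ := 0) fun I hI => by
      obtain ⟨hI₁, hI₂⟩ := card_inter_eq_rank_of_separation hdisj hunion hrank hI
      simp [hw_def, Finset.sum_sub_distrib, hI₁, hI₂, mul_comm]
  have hw₁ : w e₁ = rank N A₂ := by
    simp [hw_def, Finset.mem_coe.1 he₁, Finset.disjoint_left.1 hdisj he₁]
  have hw₂ : w e₂ = -rank N A₁ := by
    simp [hw_def, Finset.mem_coe.1 he₂, Finset.disjoint_right.1 hdisj he₂]
  have heq := hrigid w hw e₁ (hunion ▸ .inl he₁) e₂ (hunion ▸ .inr he₂)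
  have hpos : (0 : ℝ) < rank N A₁ + rank N A₂ := by exact_mod_cast hrank ▸ hk
  linarith

theorem cardRigid_iff [Finite E] (hk : 0 < k) (hkr : k ≤ N.eRank) :
    CardRigid N k ↔ N.Loopless ∧ (¬ Separable N ∨ k < N.eRank) := by
  constructor
  · refine fun h => ⟨loopless_of_cardRigid hk hkr h, ?_⟩
    rcases hkr.eq_or_lt with heq | hlt
    · exact .inl fun hsep => not_cardRigid_of_separable hk heq hsep h
    · exact .inr hlt
  · rintro ⟨hloopless, h⟩
    rcases hkr.eq_or_lt with heq | hlt
    · intro w hw e he f hf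
      by_contra hef
      exact (h.resolve_right heq.not_lt) (separable_of_mem_constSumWeights heq hw he hf hef)
    · exact cardRigid_of_lt_eRank hk hlt

end Rigidity

section Contraction

variable {E : Type*} {M : Matroid E} {F I I₀ J : Finset E} {d : ℕ}

theorem disjoint_of_contract_indep (hJ : (M ／ (F : Set E)).Indep (J : Set E)) : Disjoint J F :=
  Finset.disjoint_coe.1 (Set.disjoint_of_subset_left hJ.subset_ground Set.disjoint_sdiff_left)

section KSeparable

variable [Fintype E] [DecidableEq E] {A₁ A₂ : Finset E}

theorem kRank_rank_univ_compl (M : Matroid E) (F : Finset E) :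
    kRank M (rank M Finset.univ) Fᶜ = rank (M ／ (F : Set E)) Finset.univ := by
  have h := rank_univ_contract_add_rank M F
  rw [kRank, compl_compl]
  omega

theorem kRank_rank_univ_of_partition (hdisj : Disjoint A₁ A₂) (hunion : A₁ ∪ A₂ = Fᶜ) :
    kRank M (rank M Finset.univ) A₁ =
      rank (M ／ (F : Set E)) Finset.univ - rank (M ／ (F : Set E)) A₂ := by
  have hA : A₁ᶜ = A₂ ∪ F := by
    rw [eq_compl_comm.1 hunion, Finset.compl_union, Finset.union_inter_distrib_left,
      Finset.union_compl, Finset.inter_univ, eq_comm, Finset.union_eq_right]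
    exact Finset.subset_compl_iff_disjoint_left.2 hdisj
  have h := rank_contract_add_rank M A₂ F
  have hF := kRank_rank_univ_compl M F
  rw [← hF, kRank, kRank, hA, compl_compl]
  omega

theorem kSeparable_rank_univ_iff (hE : M.E = Set.univ) :
    KSeparable M (rank M Finset.univ) Fᶜ ↔ Separable (M ／ (F : Set E)) := by
  have hrank : ∀ A₁ A₂ : Finset E, Disjoint A₁ A₂ → A₁ ∪ A₂ = Fᶜ →
      (kRank M (rank M Finset.univ) A₁ + kRank M (rank M Finset.univ) A₂ =
          kRank M (rank M Finset.univ) Fᶜ ↔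
        rank (M ／ (F : Set E)) A₁ + rank (M ／ (F : Set E)) A₂ =
          rank (M ／ (F : Set E)) Finset.univ) := by
    intro A₁ A₂ hdisj hunion
    rw [kRank_rank_univ_compl, kRank_rank_univ_of_partition hdisj hunion,
      kRank_rank_univ_of_partition hdisj.symm (Finset.union_comm A₁ A₂ ▸ hunion)]
    omega
  constructor
  · rintro ⟨A₁, A₂, h₁, h₂, hdisj, hunion, hk⟩
    refine ⟨A₁, A₂, h₁, h₂, Finset.disjoint_coe.2 hdisj, ?_, ?_⟩
    · rw [Matroid.contract_ground, hE, ← Finset.coe_union, hunion, Finset.coe_compl,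
        Set.compl_eq_univ_sdiff]
    · rw [← coe_rank, ← coe_rank, ← coe_rank_univ]
      exact_mod_cast (hrank A₁ A₂ hdisj hunion).1 hk
  · rintro ⟨A₁, A₂, h₁, h₂, hdisj, hunion, hk⟩
    lift A₁ to Finset E using A₁.toFinite
    lift A₂ to Finset E using A₂.toFinite
    rw [Finset.disjoint_coe] at hdisj
    rw [Matroid.contract_ground, hE, ← Finset.coe_union, ← Set.compl_eq_univ_sdiff,
      ← Finset.coe_compl, Finset.coe_inj] at hunion
    rw [← coe_rank, ← coe_rank, ← coe_rank_univ] at hk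
    exact ⟨A₁, A₂, h₁, h₂, hdisj, hunion, (hrank A₁ A₂ hdisj hunion).2 (by exact_mod_cast hk)⟩

end KSeparable

variable [DecidableEq E]

/-- The independent sets of cardinality `k` that meet `F` in a basis of `F`; their incidence vectors
span the face of the polytope `P^(k)` cut out by `x(F) ≤ r(F)`. -/
def rankFaceSets (M : Matroid E) (k : ℕ) (F : Finset E) : Set (Finset E) :=
  {I ∈ indepSetsOfCard M k | (I ∩ F).card = rank M F}

theorem card_inter_le_rank (hI : M.Indep (I : Set E)) (F : Finset E) : (I ∩ F).card ≤ rank M F :=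
  card_le_rank (hI.subset (Finset.coe_subset.2 Finset.inter_subset_left)) Finset.inter_subset_right

theorem mem_rankFaceSets_of_isBasis' {k : ℕ} (hI₀ : M.IsBasis' (I₀ : Set E) (F : Set E))
    (hI₀I : I₀ ⊆ I) (hI : I ∈ indepSetsOfCard M k) : I ∈ rankFaceSets M k F := by
  refine ⟨hI, (card_inter_le_rank hI.1 F).antisymm ?_⟩
  rw [rank_eq_card hI₀]
  exact Finset.card_le_card (Finset.subset_inter hI₀I (Finset.coe_subset.1 hI₀.subset))

theorem rankFaceSets_nonempty {k : ℕ} (hF : rank M F ≤ k) (hk : k ≤ M.eRank) :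
    (rankFaceSets M k F).Nonempty := by
  obtain ⟨I₀, hI₀⟩ := exists_isBasis' M F
  obtain ⟨I, hI₀I, hI⟩ := exists_indep_superset_card_eq hI₀.indep (rank_eq_card hI₀ ▸ hF) hk
  exact ⟨I, mem_rankFaceSets_of_isBasis' hI₀ hI₀I hI⟩

theorem sdiff_mem_indepSetsOfCard_contract (hI : I ∈ rankFaceSets M (d + rank M F) F) :
    I \ F ∈ indepSetsOfCard (M ／ (F : Set E)) d := by
  obtain ⟨⟨hI, hId⟩, hIF⟩ := hI
  have hbasis : M.IsBasis' ((I ∩ F : Finset E) : Set E) F :=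
    isBasis'_of_rank_le_card (hI.subset (by simp)) Finset.inter_subset_right hIF.ge
  refine ⟨hbasis.contract_indep_iff.2 ⟨?_, ?_⟩, ?_⟩
  · rwa [← Finset.coe_union, Finset.sdiff_union_inter]
  · exact Finset.disjoint_coe.2 Finset.disjoint_sdiff
  · have := Finset.card_sdiff_add_card_inter I F
    omega

theorem union_mem_rankFaceSets (hI₀ : M.IsBasis' (I₀ : Set E) (F : Set E))
    (hJ : J ∈ indepSetsOfCard (M ／ (F : Set E)) d) :
    J ∪ I₀ ∈ rankFaceSets M (d + rank M F) F := by
  have hdisj : Disjoint J I₀ :=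
    (disjoint_of_contract_indep hJ.1).mono_right (Finset.coe_subset.1 hI₀.subset)
  refine mem_rankFaceSets_of_isBasis' hI₀ Finset.subset_union_right ⟨?_, ?_⟩
  · rw [Finset.coe_union]
    exact (hI₀.contract_indep_iff.1 hJ.1).1
  · rw [Finset.card_union_of_disjoint hdisj, hJ.2, rank_eq_card hI₀]

end Contraction

section ForbiddenSetFace

variable {E : Type*} [DecidableEq E] {M : Matroid E} {lo hi : ℕ} {F I : Finset E}

/-- The independent sets whose incidence vectors span the face cut out by the forbidden set
inequality: those of cardinality `lo` inside `F`, and those of cardinality `hi` that meet `F` in a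
basis of `F`. -/
def forbiddenSetFaceSets (M : Matroid E) (lo hi : ℕ) (F : Finset E) : Set (Finset E) :=
  indepSetsOfCard (M ↾ (F : Set E)) lo ∪ rankFaceSets M hi F

theorem forbiddenSetFaceSets_zero (M : Matroid E) (hi : ℕ) (F : Finset E) :
    forbiddenSetFaceSets M 0 hi F = insert ∅ (rankFaceSets M hi F) := by
  rw [forbiddenSetFaceSets, indepSetsOfCard_zero, Set.singleton_union]

theorem mem_forbiddenSetFaceSets_iff (hI : M.Indep (I : Set E)) :
    I ∈ forbiddenSetFaceSets M lo hi F ↔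
      (I.card = lo ∧ (I \ F).card = 0) ∨ (I.card = hi ∧ (I ∩ F).card = rank M F) := by
  simp [forbiddenSetFaceSets, rankFaceSets, indepSetsOfCard, hI, Matroid.restrict_indep_iff,
    Finset.sdiff_eq_empty_iff_subset, and_comm]

variable [Fintype E]

theorem forbiddenSetForm_incidence (M : Matroid E) (lo hi : ℕ) (F I : Finset E) :
    forbiddenSetForm M lo hi F (incidence I) =
      ((hi : ℝ) - rank M F) * (I ∩ F).card - ((rank M F : ℝ) - lo) * (I \ F).card := by
  simp [forbiddenSetForm, setSum_incidence, Finset.sdiff_eq_inter_compl]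

theorem forbiddenSetForm_single (M : Matroid E) (lo hi : ℕ) (F : Finset E) (e : E) :
    forbiddenSetForm M lo hi F (Pi.single e 1) =
      if e ∈ F then (hi : ℝ) - rank M F else -((rank M F : ℝ) - lo) := by
  by_cases he : e ∈ F <;> simp [forbiddenSetForm, setSum_single, he]

theorem forbiddenSetForm_ne_zero (hF : 0 < rank M F) (hhi : rank M F < hi) :
    forbiddenSetForm M lo hi F ≠ 0 := by
  obtain ⟨e, he⟩ : F.Nonempty := Finset.card_pos.1 (hF.trans_le (rank_le_card M F))
  intro h
  have hr : (rank M F : ℝ) < hi := by exact_mod_cast hhi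
  have h0 := forbiddenSetForm_single M lo hi F e
  rw [h, LinearMap.zero_apply, if_pos he] at h0
  linarith

theorem forbiddenSetForm_slack_of_card_le (M : Matroid E) (lo hi : ℕ) (F I : Finset E) :
    lo * ((hi : ℝ) - rank M F) - forbiddenSetForm M lo hi F (incidence I) =
      ((hi : ℝ) - rank M F) * ((lo : ℝ) - I.card) + ((hi : ℝ) - lo) * (I \ F).card := by
  rw [forbiddenSetForm_incidence, ← Finset.card_inter_add_card_sdiff I F]
  push_cast
  ring

theorem forbiddenSetForm_slack_of_le_card (M : Matroid E) (lo hi : ℕ) (F I : Finset E) :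
    lo * ((hi : ℝ) - rank M F) - forbiddenSetForm M lo hi F (incidence I) =
      ((hi : ℝ) - lo) * ((rank M F : ℝ) - (I ∩ F).card) +
        ((rank M F : ℝ) - lo) * ((I.card : ℝ) - hi) := by
  rw [forbiddenSetForm_incidence, ← Finset.card_inter_add_card_sdiff I F]
  push_cast
  ring

theorem forbiddenSetForm_incidence_le (hlo : lo < rank M F) (hhi : rank M F < hi)
    (hI : M.Indep (I : Set E)) (hcard : I.card ≤ lo ∨ hi ≤ I.card) :
    forbiddenSetForm M lo hi F (incidence I) ≤ lo * ((hi : ℝ) - rank M F) ∧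
      (forbiddenSetForm M lo hi F (incidence I) = lo * ((hi : ℝ) - rank M F) ↔
        I ∈ forbiddenSetFaceSets M lo hi F) := by
  have hr : (lo : ℝ) < rank M F := by exact_mod_cast hlo
  have hr' : (rank M F : ℝ) < hi := by exact_mod_cast hhi
  have hnonneg : ∀ {u v : ℝ}, 0 < u → 0 ≤ v → 0 ≤ u * v := fun hu hv => mul_nonneg hu.le hv
  rw [mem_forbiddenSetFaceSets_iff hI, ← sub_nonneg, eq_comm, ← sub_eq_zero]
  rcases hcard with hle | hge
  · have hle' : (I.card : ℝ) ≤ lo := by exact_mod_cast hle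
    have h₁ := hnonneg (sub_pos.2 hr') (sub_nonneg.2 hle')
    have h₂ := hnonneg (sub_pos.2 (hr.trans hr')) (Nat.cast_nonneg (I \ F).card)
    rw [forbiddenSetForm_slack_of_card_le, add_eq_zero_iff_of_nonneg h₁ h₂,
      mul_eq_zero_iff_left (sub_pos.2 hr').ne', mul_eq_zero_iff_left (sub_pos.2 (hr.trans hr')).ne',
      sub_eq_zero, Nat.cast_inj, Nat.cast_eq_zero]
    exact ⟨add_nonneg h₁ h₂, by omega⟩
  · have hge' : (hi : ℝ) ≤ I.card := by exact_mod_cast hge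
    have hIF : ((I ∩ F).card : ℝ) ≤ rank M F := by exact_mod_cast card_inter_le_rank hI F
    have h₁ := hnonneg (sub_pos.2 (hr.trans hr')) (sub_nonneg.2 hIF)
    have h₂ := hnonneg (sub_pos.2 hr) (sub_nonneg.2 hge')
    rw [forbiddenSetForm_slack_of_le_card, add_eq_zero_iff_of_nonneg h₁ h₂,
      mul_eq_zero_iff_left (sub_pos.2 (hr.trans hr')).ne', mul_eq_zero_iff_left (sub_pos.2 hr).ne',
      sub_eq_zero, sub_eq_zero, Nat.cast_inj, Nat.cast_inj]
    exact ⟨add_nonneg h₁ h₂, by omega⟩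

theorem forbiddenSetForm_incidence_of_mem (hlo : lo < rank M F) (hhi : rank M F < hi)
    (hI : I ∈ forbiddenSetFaceSets M lo hi F) :
    forbiddenSetForm M lo hi F (incidence I) = lo * ((hi : ℝ) - rank M F) := by
  have hI' := hI
  rcases hI' with hI' | hI'
  · exact (forbiddenSetForm_incidence_le hlo hhi hI'.1.of_restrict (.inl hI'.2.le)).2.2 hI
  · exact (forbiddenSetForm_incidence_le hlo hhi hI'.1.1 (.inr hI'.1.2.ge)).2.2 hI

end ForbiddenSetFace

section FaceWeights

variable {E : Type*} {M : Matroid E} {lo k d : ℕ} {F I : Finset E} {w : E → ℝ}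
  {α : ℝ}

theorem sum_of_mem_indepSetsOfCard_restrict (hw : ∀ e ∈ F, w e = α)
    (hI : I ∈ indepSetsOfCard (M ↾ (F : Set E)) lo) : ∑ e ∈ I, w e = lo * α := by
  rw [Finset.sum_eq_card_nsmul fun e he => hw e (hI.1.subset_ground he), hI.2, nsmul_eq_mul]

theorem cardRigid_restrict_of_lt_rank [M.Loopless] (hlo : 0 < lo) (hlor : lo < rank M F)
    (hF : (F : Set E) ⊆ M.E) : CardRigid (M ↾ (F : Set E)) lo := by
  have : (M ↾ (F : Set E)).Loopless := (M.restrict_isRestriction F hF).loopless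
  refine cardRigid_of_lt_eRank hlo ?_
  rw [Matroid.eRank_restrict, ← coe_rank]
  exact_mod_cast hlor

variable [DecidableEq E]

theorem sum_of_mem_rankFaceSets (hw : ∀ e ∈ F, w e = α) (hI : I ∈ rankFaceSets M k F) :
    ∑ e ∈ I, w e = rank M F * α + ∑ e ∈ I \ F, w e := by
  rw [← Finset.sum_inter_add_sum_sdiff I F,
    Finset.sum_eq_card_nsmul fun e he => hw e (Finset.mem_inter.1 he).2, hI.2, nsmul_eq_mul]

theorem mem_constSumWeights_contract
    (hw : w ∈ constSumWeights (rankFaceSets M (d + rank M F) F)) :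
    w ∈ constSumWeights (indepSetsOfCard (M ／ (F : Set E)) d) := by
  obtain ⟨I₀, hI₀⟩ := exists_isBasis' M F
  have hdisj : ∀ J ∈ indepSetsOfCard (M ／ (F : Set E)) d, Disjoint J I₀ := fun J hJ =>
    (disjoint_of_contract_indep hJ.1).mono_right (Finset.coe_subset.1 hI₀.subset)
  intro J hJ K hK
  have hsum := hw _ (union_mem_rankFaceSets hI₀ hJ) _ (union_mem_rankFaceSets hI₀ hK)
  rwa [Finset.sum_union (hdisj J hJ), Finset.sum_union (hdisj K hK), add_left_inj] at hsum

variable [Fintype E]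

theorem exists_eq_mul_forbiddenSetForm_of_cardRigid_contract [M.Loopless] (hE : M.E = Set.univ)
    (hlo : 0 < lo) (hlor : lo < rank M F) (hd : 0 < d) (hdr : (d + rank M F : ℕ) ≤ M.eRank)
    (h : CardRigid (M ／ (F : Set E)) d)
    (hw : w ∈ constSumWeights (forbiddenSetFaceSets M lo (d + rank M F) F)) :
    ∃ t : ℝ, ∀ e, w e = t * forbiddenSetForm M lo (d + rank M F) F (Pi.single e 1) := by
  have hw_lo := constSumWeights_anti Set.subset_union_left hw
  have hw_hi := constSumWeights_anti Set.subset_union_right hw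
  obtain ⟨I, hI⟩ := rankFaceSets_nonempty (Nat.le_add_left _ d) hdr
  obtain ⟨L, hLI, hL⟩ := Finset.exists_subset_card_eq (hlor.le.trans_eq hI.2.symm)
  have hL_mem : L ∈ indepSetsOfCard (M ↾ (F : Set E)) lo := by
    rw [Finset.subset_inter_iff] at hLI
    exact ⟨Matroid.restrict_indep_iff.2 ⟨hI.1.1.subset (by exact_mod_cast hLI.1),
      by exact_mod_cast hLI.2⟩, hL⟩
  have hIF := sdiff_mem_indepSetsOfCard_contract hI
  obtain ⟨e₀, he₀⟩ := Finset.card_pos.1 (hlo.trans_eq hL.symm)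
  obtain ⟨f₀, hf₀⟩ := Finset.card_pos.1 (hd.trans_eq hIF.2.symm)
  have hwF : ∀ e ∈ F, w e = w e₀ := fun e he =>
    cardRigid_restrict_of_lt_rank hlo hlor (hE ▸ Set.subset_univ _) w hw_lo e he e₀
      (hL_mem.1.subset_ground he₀)
  have hwFc : ∀ e ∉ F, w e = w f₀ := fun e he =>
    h w (mem_constSumWeights_contract hw_hi) e (by simp [hE, he]) f₀ (hIF.1.subset_ground hf₀)
  have hsum : lo * w e₀ = rank M F * w e₀ + d * w f₀ := by
    rw [← sum_of_mem_indepSetsOfCard_restrict hwF hL_mem, hw L (.inl hL_mem) I (.inr hI),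
      sum_of_mem_rankFaceSets hwF hI,
      Finset.sum_eq_card_nsmul fun e he => hwFc e (Finset.mem_sdiff.1 he).2, hIF.2, nsmul_eq_mul]
  have hd0 : (d : ℝ) ≠ 0 := by exact_mod_cast hd.ne'
  refine ⟨w e₀ / d, fun e => ?_⟩
  rw [forbiddenSetForm_single]
  split_ifs with he
  · rw [hwF e he, Nat.cast_add, add_sub_cancel_right, div_mul_cancel₀ _ hd0]
  · rw [hwFc e he]
    field_simp
    linarith

theorem cardRigid_contract_of_forall_exists_eq_mul_forbiddenSetForm (hlor : lo < rank M F)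
    (h : ∀ w ∈ constSumWeights (forbiddenSetFaceSets M lo (d + rank M F) F),
      ∃ t : ℝ, ∀ e, w e = t * forbiddenSetForm M lo (d + rank M F) F (Pi.single e 1)) :
    CardRigid (M ／ (F : Set E)) d := by
  intro w hw e he f hf
  obtain ⟨γ, hγ⟩ := exists_forall_sum_eq_of_mem_constSumWeights hw
  have hr : (rank M F : ℝ) - lo ≠ 0 := sub_ne_zero.2 (by exact_mod_cast hlor.ne')
  -- The value on `F` is the one that gives the sets of size `lo` inside `F` the total weight of the
  -- others.
  set α : ℝ := -γ / (rank M F - lo) with hα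
  set v : E → ℝ := fun x => if x ∈ F then α else w x
  have hvF : ∀ x ∈ F, v x = α := fun x hx => if_pos hx
  have hvFc : ∀ x ∉ F, v x = w x := fun x hx => if_neg hx
  have hv_mem : v ∈ constSumWeights (forbiddenSetFaceSets M lo (d + rank M F) F) := by
    refine mem_constSumWeights_of_forall_eq (γ := lo * α) ?_
    rintro I (hI | hI)
    · exact sum_of_mem_indepSetsOfCard_restrict hvF hI
    · rw [sum_of_mem_rankFaceSets hvF hI,
        Finset.sum_congr rfl fun x hx => hvFc x (Finset.mem_sdiff.1 hx).2,
        hγ _ (sdiff_mem_indepSetsOfCard_contract hI), hα]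
      field_simp
      ring
  obtain ⟨t, ht⟩ := h v hv_mem
  have hw_eq : ∀ x ∈ (M ／ (F : Set E)).E, w x = t * -((rank M F : ℝ) - lo) := by
    intro x hx
    have hxF : x ∉ F := hx.2
    rw [← hvFc x hxF, ht x, forbiddenSetForm_single, if_neg hxF]
  rw [hw_eq e he, hw_eq f hf]

theorem affDim_forbiddenSetFaceSets_add_one_eq_card_iff [M.Loopless] (hE : M.E = Set.univ)
    (hlo : 0 < lo) (hlor : lo < rank M F) (hd : 0 < d) (hdr : (d + rank M F : ℕ) ≤ M.eRank) :
    affDim (incidence '' forbiddenSetFaceSets M lo (d + rank M F) F) + 1 = Fintype.card E ↔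
      CardRigid (M ／ (F : Set E)) d := by
  have hhi : rank M F < d + rank M F := Nat.lt_add_of_pos_left hd
  rw [affDim_incidence_add_one_eq_card_iff (forbiddenSetForm_ne_zero (hlo.trans hlor) hhi)
    fun I hI => forbiddenSetForm_incidence_of_mem hlor hhi hI]
  exact ⟨cardRigid_contract_of_forall_exists_eq_mul_forbiddenSetForm hlor, fun h _ hw =>
    exists_eq_mul_forbiddenSetForm_of_cardRigid_contract hE hlo hlor hd hdr h hw⟩

end FaceWeights

section Facets

variable {E : Type*} {M : Matroid E} {k k' : ℕ} {𝓘 𝓕 : Set (Finset E)}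

theorem constSumWeights_eq_bot [M.Loopless] (hE : M.E = Set.univ) (hk : 0 < k) (hkr : k < M.eRank)
    (hkr' : k' ≤ M.eRank) (hne : k ≠ k') (h : indepSetsOfCard M k ⊆ 𝓘)
    (h' : indepSetsOfCard M k' ⊆ 𝓘) : constSumWeights 𝓘 = ⊥ := by
  obtain ⟨I, hI⟩ := indepSetsOfCard_nonempty hkr.le
  obtain ⟨J, hJ⟩ := indepSetsOfCard_nonempty hkr'
  rw [eq_bot_iff]
  intro w hw
  ext e
  have hconst : ∀ f, w f = w e := fun f => cardRigid_of_lt_eRank hk hkr w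
    (constSumWeights_anti h hw) f (hE ▸ Set.mem_univ f) e (hE ▸ Set.mem_univ e)
  have hsum : k * w e = k' * w e := by
    simpa [hconst, hI.2, hJ.2] using hw I (h hI) J (h' hJ)
  have hne' : (k : ℝ) - k' ≠ 0 := sub_ne_zero.2 (by exact_mod_cast hne)
  exact (mul_eq_zero.1 (by linarith : ((k : ℝ) - k') * w e = 0)).resolve_left hne'

variable [DecidableEq E]

theorem cardPolytope_eq_convexHull_incidence (M : Matroid E) {m : ℕ} (c : Fin m → ℕ) :
    cardPolytope M c = convexHull ℝ (incidence '' ⋃ q, indepSetsOfCard M (c q)) := by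
  rw [cardPolytope]
  congr 1
  ext x
  simp [indepSetsOfCard, eq_comm, and_assoc]

theorem definesFacet_convexHull_incidence_iff {a : (E → ℝ) →ₗ[ℝ] ℝ} {b : ℝ} (h𝓕 : 𝓕 ⊆ 𝓘)
    (hne : 𝓕.Nonempty)
    (h : ∀ I ∈ 𝓘, a (incidence I) ≤ b ∧ (a (incidence I) = b ↔ I ∈ 𝓕)) :
    DefinesFacet (convexHull ℝ (incidence '' 𝓘)) a b ↔
      affDim (incidence '' 𝓕) + 1 = affDim (incidence '' 𝓘) := by
  have htight : {v ∈ incidence '' 𝓘 | a v = b} = incidence '' 𝓕 := by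
    ext v
    constructor
    · rintro ⟨⟨I, hI, rfl⟩, hIb⟩
      exact ⟨I, (h I hI).2.1 hIb, rfl⟩
    · rintro ⟨I, hI, rfl⟩
      exact ⟨⟨I, h𝓕 hI, rfl⟩, (h I (h𝓕 hI)).2.2 hI⟩
  rw [definesFacet_convexHull_iff (by rintro _ ⟨I, hI, rfl⟩; exact (h I hI).1)
    (htight ▸ hne.image _), htight]

variable {F : Finset E}

theorem definesFacet_setSum_iff (hF : rank M F ≤ k) (hk : k ≤ M.eRank) :
    DefinesFacet (cardPolytope M ![k]) (setSum F) (rank M F) ↔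
      affDim (incidence '' rankFaceSets M k F) + 1 =
        affDim (incidence '' indepSetsOfCard M k) := by
  have hfamily : ⋃ q, indepSetsOfCard M (![k] q) = indepSetsOfCard M k := by
    simp [Set.iUnion_const]
  rw [cardPolytope_eq_convexHull_incidence, hfamily]
  refine definesFacet_convexHull_incidence_iff (Set.sep_subset _ _)
    (rankFaceSets_nonempty hF hk) fun I hI => ?_
  rw [setSum_incidence, Nat.cast_le, Nat.cast_inj]
  exact ⟨card_inter_le_rank hI.1 F, fun h => ⟨hI, h⟩, fun h => h.2⟩

variable {m : ℕ} {c : Fin m → ℕ} {i j : Fin m}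

theorem affDim_iUnion_indepSetsOfCard_of_eq_zero [Finite E] [M.Loopless] (hE : M.E = Set.univ)
    (hgap : ∀ q, c q ≤ c i ∨ c j ≤ c q) (hi : c i = 0) (hj : 0 < c j)
    (hcr : ∀ q, c q ≤ M.eRank) :
    affDim (incidence '' ⋃ q, indepSetsOfCard M (c q)) =
      affDim (incidence '' indepSetsOfCard M (c j)) + 1 := by
  have := Fintype.ofFinite E
  have hsub : ∀ q, indepSetsOfCard M (c q) ⊆ ⋃ q, indepSetsOfCard M (c q) :=
    Set.subset_iUnion fun q => indepSetsOfCard M (c q)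
  rw [← affDim_incidence_insert_empty hj.ne' (indepSetsOfCard_nonempty (hcr j)) fun I hI => hI.2]
  rcases (hcr j).eq_or_lt with heq | hlt
  · congr 2
    rw [Set.insert_eq, ← indepSetsOfCard_zero M]
    refine (Set.iUnion_subset fun q => ?_).antisymm (Set.union_subset (hi ▸ hsub i) (hsub j))
    rcases hgap q with hq | hq
    · rw [Nat.eq_zero_of_le_zero (hq.trans_eq hi)]
      exact Set.subset_union_left
    · rw [hq.antisymm (by exact_mod_cast (hcr q).trans_eq heq.symm)]
      exact Set.subset_union_right
  · rw [affDim_incidence_eq_card_of_constSumWeights_eq_bot,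
      affDim_incidence_eq_card_of_constSumWeights_eq_bot]
    · exact constSumWeights_eq_bot hE hj hlt bot_le hj.ne' (Set.subset_insert _ _)
        (indepSetsOfCard_zero M ▸ Set.singleton_subset_iff.2 (Set.mem_insert _ _))
    · exact constSumWeights_eq_bot hE hj hlt (hcr i) (by omega) (hsub j) (hsub i)

variable [Fintype E]

theorem definesFacet_forbiddenSetForm_iff (hgap : ∀ q, c q ≤ c i ∨ c j ≤ c q)
    (hlo : c i < rank M F) (hhi : rank M F < c j) (hj : c j ≤ M.eRank) :
    DefinesFacet (cardPolytope M c) (forbiddenSetForm M (c i) (c j) F)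
        (c i * ((c j : ℝ) - rank M F)) ↔
      affDim (incidence '' forbiddenSetFaceSets M (c i) (c j) F) + 1 =
        affDim (incidence '' ⋃ q, indepSetsOfCard M (c q)) := by
  rw [cardPolytope_eq_convexHull_incidence]
  refine definesFacet_convexHull_incidence_iff ?_ ((rankFaceSets_nonempty hhi.le hj).inr) ?_
  · rintro I (hI | hI)
    · exact Set.mem_iUnion.2 ⟨i, hI.1.of_restrict, hI.2⟩
    · exact Set.mem_iUnion.2 ⟨j, hI.1⟩
  · intro I hI
    obtain ⟨q, hI, hIq⟩ := Set.mem_iUnion.1 hI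
    exact forbiddenSetForm_incidence_le hlo hhi hI (hIq ▸ hgap q)

theorem definesFacet_forbiddenSetForm_iff_of_eq_zero [M.Loopless] (hE : M.E = Set.univ)
    (hgap : ∀ q, c q ≤ c i ∨ c j ≤ c q) (hi : c i = 0) (hlo : c i < rank M F)
    (hhi : rank M F < c j) (hcr : ∀ q, c q ≤ M.eRank) :
    DefinesFacet (cardPolytope M c) (forbiddenSetForm M (c i) (c j) F)
        (c i * ((c j : ℝ) - rank M F)) ↔
      DefinesFacet (cardPolytope M ![c j]) (setSum F) (rank M F) := by
  have hj : 0 < c j := by omega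
  rw [definesFacet_forbiddenSetForm_iff hgap hlo hhi (hcr j),
    definesFacet_setSum_iff hhi.le (hcr j),
    affDim_iUnion_indepSetsOfCard_of_eq_zero hE hgap hi hj hcr, hi, forbiddenSetFaceSets_zero,
    affDim_incidence_insert_empty hj.ne' (rankFaceSets_nonempty hhi.le (hcr j))
      fun I hI => hI.1.2, add_left_inj]

theorem definesFacet_forbiddenSetForm_iff_cardRigid [M.Loopless] (hE : M.E = Set.univ)
    (hgap : ∀ q, c q ≤ c i ∨ c j ≤ c q) (hi : 0 < c i) (hlo : c i < rank M F)
    (hhi : rank M F < c j) (hj : c j ≤ M.eRank) :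
    DefinesFacet (cardPolytope M c) (forbiddenSetForm M (c i) (c j) F)
        (c i * ((c j : ℝ) - rank M F)) ↔
      CardRigid (M ／ (F : Set E)) (c j - rank M F) := by
  have hij : c i < c j := hlo.trans hhi
  have hsub : ∀ q, indepSetsOfCard M (c q) ⊆ ⋃ q, indepSetsOfCard M (c q) :=
    Set.subset_iUnion fun q => indepSetsOfCard M (c q)
  have hfull : constSumWeights (⋃ q, indepSetsOfCard M (c q)) = ⊥ :=
    constSumWeights_eq_bot hE hi ((Nat.cast_lt.2 hij).trans_le hj) hj hij.ne (hsub i) (hsub j)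
  have hd : c j - rank M F + rank M F = c j := Nat.sub_add_cancel hhi.le
  rw [definesFacet_forbiddenSetForm_iff hgap hlo hhi hj,
    affDim_incidence_eq_card_of_constSumWeights_eq_bot hfull,
    ← affDim_forbiddenSetFaceSets_add_one_eq_card_iff hE hi hlo (Nat.sub_pos_of_lt hhi)
      (hd.symm ▸ hj), hd]

theorem definesFacet_forbiddenSetForm_iff_of_pos [M.Loopless] (hE : M.E = Set.univ)
    (hgap : ∀ q, c q ≤ c i ∨ c j ≤ c q) (hi : 0 < c i) (hlo : c i < rank M F)
    (hhi : rank M F < c j) (hj : c j ≤ rank M Finset.univ) :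
    DefinesFacet (cardPolytope M c) (forbiddenSetForm M (c i) (c j) F)
        (c i * ((c j : ℝ) - rank M F)) ↔
      M.IsFlat (F : Set E) ∧ (KInseparable M (c j) Fᶜ ∨ c j < rank M Finset.univ) := by
  have hrank := rank_univ_contract_add_rank M F
  rw [definesFacet_forbiddenSetForm_iff_cardRigid hE hgap hi hlo hhi
      (coe_rank_univ M ▸ Nat.cast_le.2 hj),
    cardRigid_iff (Nat.sub_pos_of_lt hhi) (by rw [← coe_rank_univ, Nat.cast_le]; omega),
    loopless_contract_iff_isFlat (hE ▸ Set.subset_univ _), ← coe_rank_univ, Nat.cast_lt,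
    show c j - rank M F < rank (M ／ (F : Set E)) Finset.univ ↔ c j < rank M Finset.univ by omega]
  refine and_congr_right fun _ => ?_
  rcases hj.eq_or_lt with heq | hlt
  · rw [KInseparable, heq, kSeparable_rank_univ_iff hE]
  · simp only [hlt, or_true]

end Facets

end CardMatroid

theorem theoremT {E : Type*} [Fintype E] [DecidableEq E]
    (M : Matroid E) (hE : M.E = Set.univ) (hM : M.Loopless)
    (m : ℕ) (c : Fin m → ℕ) (hc : StrictMono c)
    (hcr : ∀ i, c i ≤ CardMatroid.rank M Finset.univ)
    (p : ℕ) (hp : p + 1 < m) (F : Finset E)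
    (hlo : c ⟨p, by omega⟩ < CardMatroid.rank M F)
    (hhi : CardMatroid.rank M F < c ⟨p + 1, hp⟩) :
    CardMatroid.DefinesFacet (CardMatroid.cardPolytope M c)
        (CardMatroid.forbiddenSetForm M (c ⟨p, by omega⟩) (c ⟨p + 1, hp⟩) F)
        ((c ⟨p, by omega⟩ : ℝ) * ((c ⟨p + 1, hp⟩ : ℝ) - (CardMatroid.rank M F : ℝ))) ↔
      (c ⟨p, by omega⟩ = c ⟨0, by omega⟩ ∧ c ⟨0, by omega⟩ = 0 ∧
        CardMatroid.DefinesFacet (CardMatroid.cardPolytope M ![c ⟨p + 1, hp⟩])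
          (CardMatroid.setSum F) (CardMatroid.rank M F : ℝ)) ∨
      (0 < c ⟨p, by omega⟩ ∧ M.IsFlat (F : Set E) ∧
        (CardMatroid.KInseparable M (c ⟨p + 1, hp⟩) Fᶜ ∨
          c ⟨p + 1, hp⟩ < CardMatroid.rank M Finset.univ)) := by
  set i : Fin m := ⟨p, by omega⟩
  set j : Fin m := ⟨p + 1, hp⟩
  have hgap : ∀ q, c q ≤ c i ∨ c j ≤ c q := fun q =>
    (Nat.lt_or_ge p q).symm.imp (fun h => hc.monotone h) (fun h => hc.monotone h)
  have hmin : c ⟨0, by omega⟩ ≤ c i := hc.monotone (Nat.zero_le p)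
  rcases Nat.eq_zero_or_pos (c i) with hi | hi
  · rw [CardMatroid.definesFacet_forbiddenSetForm_iff_of_eq_zero hE hgap hi hlo hhi
      fun q => CardMatroid.coe_rank_univ M ▸ Nat.cast_le.2 (hcr q)]
    have hfirst : c ⟨0, by omega⟩ = 0 := Nat.eq_zero_of_le_zero (hmin.trans_eq hi)
    simp only [hi, hfirst, lt_irrefl, true_and, false_and, or_false]
  · rw [CardMatroid.definesFacet_forbiddenSetForm_iff_of_pos hE hgap hi hlo hhi (hcr j)]
    exact ⟨fun h => .inr ⟨hi, h⟩, fun h => (h.resolve_left fun h0 => hi.ne' (h0.1.trans h0.2.1)).2⟩
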